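/- Let $m\ge 0$ and let $K$ be a (finite, abstract) simplicial complex on $[m]=\{1,\dots,m\}$, that is, a family of subsets of $[m]$ that contains $\emptyset$ and is closed under passing to subsets. A vertex of $K$ is an element $i\in[m]$ with $\{i\}\in K$ (elements of $[m]$ that are not vertices are allowed), and a vertex $i$ of $K$ is called conelike if $\{i,j\}\in K$ for every vertex $j\neq i$ of $K$. Let $D^2\subset\mathbb{C}$ be the closed unit disk, $S^1=\partial D^2$ the unit circle, and let $$Z_K(D^2,S^1)=\bigcup_{J\in K}\Bigl(\prod_{i\in J}D^2\times\prod_{i\notin J}S^1\Bigr)\subset\mathbb{C}^m$$ be the complex moment-angle complex of $K$, with the subspace topology. If $K$ has at least one vertex that is not conelike, then $Z_K(D^2,S^1)$ is not aspherical, where a space $X$ is called aspherical if it is path-connected and $\pi_n(X,x)$ is trivial for all $n\ge 2$ and all $x\in X$. -/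

import Mathlib

open scoped Topology

/-- `i` is a vertex of `K`. The underlying set `ι` of `K` may also contain elements
that are not vertices of `K`. -/
def IsVertex {ι : Type*} (K : PreAbstractSimplicialComplex ι) (i : ι) : Prop :=
  ({i} : Finset ι) ∈ K

/-- `i` is joined by an edge of `K` to every other vertex of `K` (used for vertices `i`). -/
def IsConelike {ι : Type*} [DecidableEq ι] (K : PreAbstractSimplicialComplex ι) (i : ι) : Prop :=
  ∀ j : ι, IsVertex K j → j ≠ i → ({i, j} : Finset ι) ∈ K

/-- The polyhedral product
`Z_K(A, B) = ⋃_{J ∈ K} (∏_{i ∈ J} A i × ∏_{i ∉ J} B i)`, as a subset of the product `∏ i, X i`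
of the ambient spaces. The empty simplex belongs to every simplicial complex; it is listed
separately because the faces of a `PreAbstractSimplicialComplex` are nonempty by convention. -/
def polyhedralProduct {ι : Type*} {X : ι → Type*} (K : PreAbstractSimplicialComplex ι)
    (A B : ∀ i, Set (X i)) : Set (∀ i, X i) :=
  {x | ∃ J : Finset ι, (J = ∅ ∨ J ∈ K) ∧ (∀ i ∈ J, x i ∈ A i) ∧ ∀ i ∉ J, x i ∈ B i}

/-- The complex moment-angle complex `Z_K(D², S¹)`, where `D²` is the closed unit disk in `ℂ`
and `S¹` is its boundary circle. -/
def complexMomentAngleComplex {ι : Type*} (K : PreAbstractSimplicialComplex ι) : Set (ι → ℂ) :=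
  polyhedralProduct K (fun _ => Metric.closedBall (0 : ℂ) 1) (fun _ => Metric.sphere (0 : ℂ) 1)

/-- A space is aspherical if it is path-connected and all its homotopy groups in degrees
at least `2` are trivial. -/
structure IsAspherical (X : Type*) [TopologicalSpace X] : Prop where
  pathConnectedSpace : PathConnectedSpace X
  subsingleton_pi : ∀ n : ℕ, 2 ≤ n → ∀ x : X, Subsingleton (π_ n X x)

open scoped Topology unitInterval

open MeasureTheory Metric

/-! Pick a vertex `i` that is not conelike and a vertex `j ≠ i` with `{i, j}` not in `K`. No face
contains both, so a point of `Z_K` never has both coordinates zero: projection to these coordinates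
lands in `ℂ² ∖ 0`. Conversely `∂(D² × D²)`, a 3-sphere, sits in `Z_K` with all other coordinates
equal to 1. The composite is the inclusion of the sphere into `ℂ² ∖ 0`, which is essential, so `π₃`
is nontrivial (`not_subsingleton_pi_three`).

Essentiality rests on the no-retraction theorem (`not_contDiff_retraction`), proved by volume. If
`f` retracts the ball onto its boundary, then `x + t (f x - x)` permutes the ball for small `t`, so
its Jacobian integral is the volume. The integral is polynomial in `t`, hence is the volume at `t =
1` too, where the Jacobian of `f` vanishes. -/

/-! ### No-retraction theorem by the volume argument -/

/-- Lagrange interpolation of the polynomial `s ↦ det (1 + s A)`. -/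
theorem exists_det_one_add_eq_sum {E : Type*} [NormedAddCommGroup E] [NormedSpace ℝ E]
    [FiniteDimensional ℝ E] (t : Fin (Module.finrank ℝ E + 1) → ℝ) (ht : Function.Injective t) :
    ∃ c : Fin (Module.finrank ℝ E + 1) → ℝ, ∑ j, c j = 1 ∧
      ∀ A : E →L[ℝ] E, (1 + A).det = ∑ j, c j * (1 + t j • A).det := by
  open Polynomial in
  have key : ∀ A : E →L[ℝ] E,
      (1 + A).det = ∑ j, (Lagrange.basis Finset.univ t j).eval 1 * (1 + t j • A).det := by
    intro A
    let b := Module.finBasis ℝ E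
    let M := LinearMap.toMatrix b b (A : E →ₗ[ℝ] E)
    let p : ℝ[X] := Matrix.det ((X : ℝ[X]) • M.map C + (1 : Matrix _ _ ℝ).map C)
    have hp : ∀ s : ℝ, p.eval s = (1 + s • A).det := by
      intro s
      have h1 : (1 + s • A).det = Matrix.det (1 + s • M) := by
        rw [ContinuousLinearMap.det, ← LinearMap.det_toMatrix b]
        congr 1
        have : ((1 + s • A : E →L[ℝ] E) : E →ₗ[ℝ] E) = LinearMap.id + s • (A : E →ₗ[ℝ] E) := rfl
        rw [this, map_add, map_smul, LinearMap.toMatrix_id]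
      rw [h1, ← coe_evalRingHom, RingHom.map_det]
      congr 1
      ext i j
      simpa [Matrix.map_apply, add_comm, Matrix.one_apply, apply_ite] using mul_comm _ _
    have hdeg : p.degree < (Finset.univ : Finset (Fin (Module.finrank ℝ E + 1))).card := by
      refine lt_of_le_of_lt degree_le_natDegree ?_
      have := natDegree_det_X_add_C_le M 1
      rw [Fintype.card_fin] at this
      rw [Finset.card_univ, Fintype.card_fin]
      exact_mod_cast Nat.lt_succ_of_le this
    have h := Lagrange.eq_interpolate (v := t) ht.injOn hdeg
    have h2 := congrArg (eval 1) h
    rw [hp, one_smul, Lagrange.interpolate_apply, eval_finsetSum] at h2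
    rw [h2]
    refine Finset.sum_congr rfl fun j _ => ?_
    rw [eval_mul, eval_C, hp, mul_comm]
  refine ⟨_, ?_, key⟩
  -- The case `A = 0` says that the coefficients sum to 1.
  have := key 0
  simp only [smul_zero, add_zero] at this
  have h1 : (1 : E →L[ℝ] E).det = 1 := LinearMap.det_id
  simpa [h1] using this.symm

/-- A small Lipschitz perturbation of the identity that is supported in a set `s` maps `s` onto
itself. -/
theorem image_add_smul_eq_of_lipschitzWith {E : Type*} [NormedAddCommGroup E] [NormedSpace ℝ E]
    [CompleteSpace E] {g : E → E} {K : NNReal} (hg : LipschitzWith K g) {s : Set E}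
    (hs : ∀ x ∉ s, g x = 0) {t : ℝ} (ht : ‖t‖ * K < 1) :
    Function.Injective (fun x => x + t • g x) ∧ (fun x => x + t • g x) '' s = s := by
  have ha : ApproximatesLinearOn (fun x => x + t • g x)
      ((ContinuousLinearEquiv.refl ℝ E : E ≃L[ℝ] E) : E →L[ℝ] E) Set.univ (‖t‖₊ * K) := by
    rw [ApproximatesLinearOn.approximatesLinearOn_iff_lipschitzOnWith, lipschitzOnWith_univ]
    have : (fun x => x + t • g x) - ⇑((ContinuousLinearEquiv.refl ℝ E : E ≃L[ℝ] E) : E →L[ℝ] E)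
        = fun x => t • g x := by
      ext x; simp
    rw [this]
    exact (lipschitzWith_smul t).comp hg
  have hc : Subsingleton E ∨ ‖t‖₊ * K <
      ‖((ContinuousLinearEquiv.refl ℝ E).symm : E →L[ℝ] E)‖₊⁻¹ := by
    rcases subsingleton_or_nontrivial E with h | h
    · exact Or.inl h
    · right
      have : ‖((ContinuousLinearEquiv.refl ℝ E).symm : E →L[ℝ] E)‖₊ = 1 := by
        ext; exact ContinuousLinearMap.norm_id
      rw [this, inv_one]
      exact_mod_cast ht
  have hinj := Set.injOn_univ.1 (ha.injOn hc)
  have hsur := ha.surjective hc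
  refine ⟨hinj, ?_⟩
  have h1 : (fun x => x + t • g x) '' sᶜ = sᶜ := by
    have : Set.EqOn (fun x => x + t • g x) id sᶜ := fun x hx => by simp [hs x hx]
    rw [this.image_eq, Set.image_id]
  rw [← compl_inj_iff, ← Set.image_compl_eq (show Function.Bijective _ from ⟨hinj, hsur⟩), h1]

/-- The truncation to a ball of a map that is Lipschitz there and vanishes on the boundary sphere
is Lipschitz. -/
theorem lipschitzWith_piecewise_closedBall {E : Type*} [NormedAddCommGroup E] [NormedSpace ℝ E]
    {v : E → E} {K : NNReal} {R : ℝ} (hv : LipschitzOnWith K v (closedBall 0 R))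
    (h0 : ∀ x, ‖x‖ = R → v x = 0) :
    LipschitzWith K (fun x => open Classical in if x ∈ closedBall 0 R then v x else 0) := by
  have mixed : ∀ x y, x ∈ closedBall (0 : E) R → y ∉ closedBall (0 : E) R →
      dist (v x) 0 ≤ K * dist x y := by
    intro x y hx hy
    rw [mem_closedBall_zero_iff] at hx hy
    push Not at hy
    -- The segment from `x` to `y` meets the sphere at some `z`; there `v` vanishes, and `z` is no
    -- farther from `x` than `y` is.
    have hcont : ContinuousOn (fun s : ℝ => ‖AffineMap.lineMap x y s‖) (Set.Icc 0 1) := by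
      apply Continuous.continuousOn
      exact (AffineMap.lineMap_continuous (R := ℝ) (p := x) (q := y)).norm
    have hm : R ∈ Set.Icc ‖(AffineMap.lineMap x y (0 : ℝ) : E)‖
        ‖(AffineMap.lineMap x y (1 : ℝ) : E)‖ := by
      simpa using ⟨hx, hy.le⟩
    obtain ⟨s, hs, hsR⟩ := intermediate_value_Icc zero_le_one hcont hm
    set z : E := AffineMap.lineMap x y s with hz
    have hzR : ‖z‖ = R := hsR
    rw [← h0 z hzR]
    refine (hv.dist_le_mul x (by simpa using hx) z (by simp [hzR])).trans ?_
    gcongr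
    rw [hz, dist_left_lineMap]
    have : ‖s‖ ≤ 1 := by rw [Real.norm_eq_abs, abs_le]; constructor <;> linarith [hs.1, hs.2]
    exact mul_le_of_le_one_left dist_nonneg this
  refine LipschitzWith.of_dist_le_mul fun x y => ?_
  by_cases hx : x ∈ closedBall (0 : E) R <;> by_cases hy : y ∈ closedBall (0 : E) R
  · simpa [hx, hy] using hv.dist_le_mul x hx y hy
  · simp only [hx, hy, if_true, if_false]; exact mixed x y hx hy
  · simp only [hx, hy, if_true, if_false]
    rw [dist_comm, dist_comm x]; exact mixed y x hy hx
  · simp [hx, hy]; positivity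

/-- The derivative of a map between open subsets of spheres is singular. -/
theorem det_fderiv_eq_zero_of_norm_eq {E : Type*} [NormedAddCommGroup E] [InnerProductSpace ℝ E]
    [FiniteDimensional ℝ E] {f : E → E} {R : ℝ} (hR : 0 < R) {x : E}
    (hf : DifferentiableAt ℝ f x) (hn : ∀ᶠ y in 𝓝 x, ‖f y‖ = R) : (fderiv ℝ f x).det = 0 := by
  by_contra hdet
  have hu : IsUnit (LinearMap.det (fderiv ℝ f x : E →ₗ[ℝ] E)) := isUnit_iff_ne_zero.2 hdet
  -- Differentiating `‖f‖² = R²` makes the image of the derivative orthogonal to `f x`; an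
  -- invertible derivative would attain `f x` itself.
  obtain ⟨v, hv⟩ := ((Module.End.isUnit_iff _).1
    ((LinearMap.isUnit_iff_isUnit_det _).2 hu)).surjective (f x)
  have h1 := (hf.hasFDerivAt.inner ℝ hf.hasFDerivAt)
  have h2 : (fun y => inner ℝ (f y) (f y)) =ᶠ[𝓝 x] fun _ => R ^ 2 := by
    filter_upwards [hn] with y hy
    rw [real_inner_self_eq_norm_sq, hy]
  have h3 := h1.unique ((hasFDerivAt_const (R ^ 2) x).congr_of_eventuallyEq h2)
  have h4 := congrArg (fun L : E →L[ℝ] ℝ => L v) h3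
  have hv' : fderiv ℝ f x v = f x := hv
  simp [fderivInnerCLM_apply, hv', hn.self_of_nhds] at h4
  exact hR.ne' h4

/-- There is no continuously differentiable retraction of a ball onto its boundary sphere. -/
theorem not_contDiff_retraction {E : Type*} [NormedAddCommGroup E] [InnerProductSpace ℝ E]
    [FiniteDimensional ℝ E] {f : E → E} (hf : ContDiff ℝ 1 f) {R : ℝ} (hR : 0 < R)
    (hid : ∀ x, ‖x‖ = R → f x = x) (hn : ∀ x, ‖x‖ ≤ R → ‖f x‖ = R) : False := by
  borelize E
  let μ : Measure E := Measure.addHaar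
  have hv : ContDiff ℝ 1 (fun x => f x - x) := hf.sub contDiff_id
  obtain ⟨K, hK⟩ := hv.contDiffOn.exists_lipschitzOnWith one_ne_zero (convex_closedBall (0 : E) R)
    (isCompact_closedBall 0 R)
  have hg := lipschitzWith_piecewise_closedBall hK (fun x hx => by simp [hid x hx])
  set g : E → E := fun x => open Classical in if x ∈ closedBall 0 R then f x - x else 0 with hgdef
  have hgs : ∀ x ∉ ball (0 : E) R, g x = 0 := by
    intro x hx
    by_cases h : x ∈ closedBall (0 : E) R
    · have : ‖x‖ = R := le_antisymm (by simpa using h) (by simpa using hx)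
      simp [hgdef, hid x this]
    · exact if_neg h
  let D : E → E →L[ℝ] E := fun x => fderiv ℝ (fun x => f x - x) x
  have hDc : Continuous D := hv.continuous_fderiv one_ne_zero
  have hgd : ∀ x ∈ ball (0 : E) R, HasFDerivAt g (D x) x := by
    intro x hx
    have h1 : HasFDerivAt (fun x => f x - x) (D x) x :=
      (hv.differentiable one_ne_zero x).hasFDerivAt
    refine h1.congr_of_eventuallyEq ?_
    filter_upwards [isOpen_ball.mem_nhds hx] with y hy
    exact if_pos (ball_subset_closedBall hy)
  have hDK : ∀ x ∈ ball (0 : E) R, ‖D x‖ ≤ K := fun x hx =>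
    (hgd x hx).le_of_lipschitz hg
  -- Positivity of the determinant removes the absolute value in the change of variables.
  obtain ⟨δ, hδ, hδdet⟩ : ∃ δ > 0, ∀ A : E →L[ℝ] E, ‖A‖ < δ → 0 < (1 + A).det := by
    have hc : Continuous fun A : E →L[ℝ] E => (1 + A).det :=
      ContinuousLinearMap.continuous_det.comp (continuous_const.add continuous_id)
    have h0 : (0 : ℝ) < (1 + (0 : E →L[ℝ] E)).det := by
      rw [add_zero]
      exact lt_of_lt_of_eq one_pos LinearMap.det_id.symm
    obtain ⟨δ, hδ, h⟩ := Metric.eventually_nhds_iff.1 (hc.continuousAt.eventually_const_lt h0)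
    exact ⟨δ, hδ, fun A hA => h (by simpa using hA)⟩
  have hvol : ∀ t : ℝ, ‖t‖ * K < 1 → ‖t‖ * K < δ →
      ∫ x in ball (0 : E) R, (1 + t • D x).det ∂μ = μ.real (ball 0 R) := by
    intro t ht htδ
    obtain ⟨hinj, him⟩ := image_add_smul_eq_of_lipschitzWith hg hgs ht
    have h := integral_image_eq_integral_abs_det_fderiv_smul μ
      (measurableSet_ball (x := (0 : E)) (ε := R))
      (f := fun x => x + t • g x) (f' := fun x => 1 + t • D x)
      (fun x hx => ((hasFDerivAt_id x).add ((hgd x hx).const_smul t)).hasFDerivWithinAt)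
      hinj.injOn (fun _ => (1 : ℝ))
    rw [him] at h
    simp only [smul_eq_mul, mul_one, integral_const, MeasurableSet.univ,
      measureReal_restrict_apply, Set.univ_inter] at h
    rw [h]
    refine setIntegral_congr_fun measurableSet_ball fun x hx => ?_
    refine (abs_of_pos (hδdet _ ?_)).symm
    rw [norm_smul]
    exact (mul_le_mul_of_nonneg_left (hDK x hx) (norm_nonneg _)).trans_lt htδ
  -- With this `N`, all nodes `1 / (N + j)` are small enough for `hvol`.
  obtain ⟨N, hN⟩ := exists_nat_gt ((K + 1) / min 1 δ : ℝ)
  have hm : 0 < min 1 δ := lt_min one_pos hδ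
  have hNpos : (0 : ℝ) < N := lt_of_le_of_lt (by positivity) hN
  have hnode : ∀ j : ℕ, ‖((N + j : ℝ)⁻¹)‖ * K < min 1 δ := by
    intro j
    have hj : (0 : ℝ) < N + j := by positivity
    rw [Real.norm_of_nonneg (by positivity), inv_mul_lt_iff₀ hj]
    rw [div_lt_iff₀ hm] at hN
    have : (0 : ℝ) ≤ j * min 1 δ := by positivity
    nlinarith
  obtain ⟨c, hc1, hc⟩ := exists_det_one_add_eq_sum (E := E)
    (fun j => ((N + (j : ℕ) : ℝ)⁻¹)) (by
      intro i j hij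
      have : (N + (i : ℕ) : ℝ) = N + (j : ℕ) := inv_injective hij
      exact Fin.ext (by exact_mod_cast add_left_cancel this))
  have hint : ∀ t : ℝ, IntegrableOn (fun x => (1 + t • D x).det) (ball (0 : E) R) μ := by
    intro t
    have : Continuous fun x => (1 + t • D x).det :=
      ContinuousLinearMap.continuous_det.comp (continuous_const.add (hDc.const_smul t))
    exact (this.continuousOn.integrableOn_compact (isCompact_closedBall 0 R)).mono_set
      ball_subset_closedBall
  have htotal : ∫ x in ball (0 : E) R, (1 + D x).det ∂μ = μ.real (ball 0 R) := by
    rw [integral_congr_ae (Filter.Eventually.of_forall fun x => hc (D x))]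
    rw [integral_finsetSum _ fun j _ => (hint _).const_mul _]
    simp_rw [integral_const_mul]
    rw [Finset.sum_congr rfl fun j _ => by
      rw [hvol _ ((hnode j).trans_le (min_le_left _ _)) ((hnode j).trans_le (min_le_right _ _))]]
    rw [← Finset.sum_mul, hc1, one_mul]
  have hzero : ∫ x in ball (0 : E) R, (1 + D x).det ∂μ = 0 := by
    refine setIntegral_eq_zero_of_forall_eq_zero fun x hx => ?_
    have hd : DifferentiableAt ℝ f x := hf.differentiable one_ne_zero x
    have : 1 + D x = fderiv ℝ f x := by
      simp only [D]
      rw [fderiv_fun_sub hd differentiableAt_fun_id,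
        show fderiv ℝ (fun y : E => y) x = 1 from fderiv_id]
      abel
    rw [this]
    refine det_fderiv_eq_zero_of_norm_eq hR hd ?_
    filter_upwards [isOpen_ball.mem_nhds hx] with y hy
    exact hn y (by simpa using (mem_ball.1 hy).le)
  rw [hzero] at htotal
  have hpos : 0 < μ.real (ball (0 : E) R) :=
    ENNReal.toReal_pos (measure_ball_pos μ 0 hR).ne' measure_ball_lt_top.ne
  exact hpos.ne htotal

/-! ### Zeros of continuous maps that are the identity near infinity -/

/-- A continuous self-map of a Euclidean space that is the identity far from the origin has a
zero. -/
theorem exists_eq_zero_of_eq_id_of_le_norm_inner {E : Type*} [NormedAddCommGroup E]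
    [InnerProductSpace ℝ E] [FiniteDimensional ℝ E] {h : E → E} (hc : Continuous h) {C : ℝ}
    (hC : 0 < C) (hid : ∀ x, C ≤ ‖x‖ → h x = x) : ∃ x, h x = 0 := by
  by_contra! hne
  obtain ⟨ε, hε, hlow⟩ : ∃ ε > 0, ∀ x, ε ≤ ‖h x‖ := by
    obtain ⟨x₀, -, hx₀⟩ := (isCompact_closedBall (0 : E) C).exists_isMinOn
      ⟨0, by simpa using hC.le⟩ hc.norm.continuousOn
    refine ⟨min ‖h x₀‖ C, lt_min (norm_pos_iff.2 (hne x₀)) hC, fun x => ?_⟩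
    rcases le_or_gt C ‖x‖ with hx | hx
    · rw [hid x hx]; exact (min_le_right _ _).trans hx
    · exact (min_le_left _ _).trans (hx₀ (by simpa using hx.le))
  have hwc : Continuous fun x => h x - x := hc.sub continuous_id
  have hws : HasCompactSupport fun x => h x - x := by
    refine HasCompactSupport.intro (isCompact_closedBall (0 : E) C) fun x hx => ?_
    rw [mem_closedBall_zero_iff, not_le] at hx
    rw [hid x hx.le, sub_self]
  have hwu : UniformContinuous fun x => h x - x := hws.uniformContinuous_of_continuous hwc
  obtain ⟨δ, hδ, hwδ⟩ := Metric.uniformContinuous_iff.1 hwu (ε / 2) (half_pos hε)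
  obtain ⟨g, hg, hgw⟩ := hwc.exists_contDiff_dist_le_of_forall_mem_ball_dist_le hδ
  have hk0 : ∀ x, x + g x ≠ 0 := by
    intro x hx
    have h1 := hgw x (ε / 2) fun y hy => (hwδ (mem_ball.1 hy)).le
    have h2 : g x - (h x - x) = -h x := by
      rw [eq_neg_of_add_eq_zero_right hx]; abel
    rw [dist_eq_norm, h2, norm_neg] at h1
    linarith [hlow x]
  -- Smoothing is local: where `h - id` vanishes on a whole `δ`-ball, the error bound 0 forces `g x
  -- = 0`.
  have hkid : ∀ x, C + δ ≤ ‖x‖ → g x = 0 := by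
    intro x hx
    have hw0 : ∀ y, C ≤ ‖y‖ → h y - y = 0 := fun y hy => by rw [hid y hy, sub_self]
    have h1 := hgw x 0 fun y hy => by
      have h2 : ‖x‖ ≤ ‖y‖ + dist y x := by
        rw [dist_comm, dist_eq_norm]; linarith [norm_sub_norm_le x y]
      rw [hw0 y (by linarith [mem_ball.1 hy]), hw0 x (by linarith), dist_self]
    rw [hw0 x (by linarith)] at h1
    simpa using h1
  have hk : ContDiff ℝ 1 fun x => x + g x := contDiff_id.add (hg.of_le (by simp))
  have hR : 0 < C + δ := by positivity
  refine not_contDiff_retraction (f := fun x => ((C + δ) * ‖x + g x‖⁻¹) • (x + g x)) ?_ hR ?_ ?_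
  · exact (contDiff_const.mul ((hk.norm ℝ hk0).inv fun x => norm_ne_zero_iff.2 (hk0 x))).smul hk
  · intro x hx
    simp only [hkid x hx.ge, add_zero, hx]
    rw [mul_inv_cancel₀ hR.ne', one_smul]
  · intro x _
    have := norm_ne_zero_iff.2 (hk0 x)
    rw [norm_smul, norm_mul, norm_inv, norm_norm, mul_assoc, inv_mul_cancel₀ this, mul_one,
      Real.norm_of_nonneg hR.le]

/-- A continuous self-map of a finite-dimensional normed space that is the identity far from the
origin has a zero. -/
theorem exists_eq_zero_of_eq_id_of_le_norm {E : Type*} [NormedAddCommGroup E]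
    [NormedSpace ℝ E] [FiniteDimensional ℝ E] {h : E → E} (hc : Continuous h) {C : ℝ}
    (hid : ∀ x, C ≤ ‖x‖ → h x = x) : ∃ x, h x = 0 := by
  let e := toEuclidean (E := E)
  let A : E →L[ℝ] EuclideanSpace ℝ (Fin (Module.finrank ℝ E)) := e
  obtain ⟨x, hx⟩ := exists_eq_zero_of_eq_id_of_le_norm_inner
    (h := fun x => e (h (e.symm x))) (by fun_prop)
    (C := (‖A‖ + 1) * (|C| + 1)) (by positivity) (by
      intro x hx
      have h1 : ‖x‖ ≤ (‖A‖ + 1) * ‖e.symm x‖ := by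
        have := A.le_opNorm (e.symm x)
        simp only [A, ContinuousLinearEquiv.coe_coe, ContinuousLinearEquiv.apply_symm_apply] at this
        linarith [norm_nonneg (e.symm x)]
      have h2 := le_of_mul_le_mul_left (hx.trans h1) (by positivity)
      rw [hid _ (by linarith [le_abs_self C]), e.apply_symm_apply])
  exact ⟨e.symm x, by simpa using hx⟩

/-! ### An explicit essential map to the sphere -/

/-- A map `Y → Y × ℝ` that, up to positive factors, wraps the ball `{y | ‖y‖ ≤ 1}` once
around the unit sphere of `Y × ℝ` and sends the rest of `Y` to the pole `(0, 1)`. -/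
def sphereWrap {Y : Type*} [NormedAddCommGroup Y] [NormedSpace ℝ Y] (y : Y) : Y × ℝ :=
  (max (1 - ‖y‖) 0 • y, 2 * ‖y‖ - 1)

section sphereWrap

variable {Y : Type*} [NormedAddCommGroup Y] [NormedSpace ℝ Y]

theorem continuous_sphereWrap : Continuous (sphereWrap : Y → Y × ℝ) := by
  unfold sphereWrap; fun_prop

theorem sphereWrap_of_one_le_norm {y : Y} (hy : 1 ≤ ‖y‖) :
    sphereWrap y = (2 * ‖y‖ - 1) • ((0 : Y), (1 : ℝ)) := by
  simp [sphereWrap, max_eq_right (show 1 - ‖y‖ ≤ 0 by linarith)]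

theorem sphereWrap_ne_zero (y : Y) : sphereWrap y ≠ 0 := by
  intro h
  have h1 : max (1 - ‖y‖) 0 • y = 0 := congrArg Prod.fst h
  have h2 : 2 * ‖y‖ - 1 = 0 := congrArg Prod.snd h
  rcases smul_eq_zero.1 h1 with h1 | h1
  · linarith [le_max_left (1 - ‖y‖) 0]
  · rw [h1, norm_zero] at h2; norm_num at h2

/-- The map `sphereWrap` is not null-homotopic relative to the outside of the unit ball as a map
to the complement of the origin. -/
theorem not_nullhomotopic_sphereWrap [FiniteDimensional ℝ Y] {H : Y × ℝ → Y × ℝ}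
    (hc : Continuous H) (hne : ∀ x, H x ≠ 0)
    (hwrap : ∀ y s, s ≤ -1 ∨ 1 ≤ ‖y‖ → ∃ c > (0 : ℝ), H (y, s) = c • sphereWrap y)
    (htop : ∀ y s, 1 ≤ s → ∃ c > (0 : ℝ), H (y, s) = c • ((0 : Y), (1 : ℝ))) : False := by
  -- Interpolate from `H` inside the unit ball to the identity beyond radius 2. A zero can only
  -- occur for `1 ≤ r < 2`, where `H x` and `x` must be shown never to cancel.
  obtain ⟨⟨y, s⟩, hx⟩ := exists_eq_zero_of_eq_id_of_le_norm
    (h := fun x => max 0 (2 - ‖x‖) • H x + min 1 (max 0 (‖x‖ - 1)) • x) (by fun_prop) (C := 2)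
    (fun x hx => by
      rw [max_eq_left (by linarith), max_eq_right (by linarith), min_eq_left (by linarith)]; simp)
  set r := ‖(y, s)‖ with hr
  have hb : 0 ≤ min 1 (max 0 (r - 1)) := by positivity
  rcases le_or_gt 2 r with h2 | h2
  · rw [max_eq_left (by linarith), max_eq_right (by linarith), min_eq_left (by linarith), zero_smul,
      zero_add, one_smul] at hx
    rw [hr, hx, norm_zero] at h2
    norm_num at h2
  have ha : 0 < max 0 (2 - r) := lt_max_of_lt_right (by linarith)
  rcases lt_or_ge r 1 with h1 | h1
  · rw [max_eq_left (show r - 1 ≤ 0 by linarith), min_eq_right zero_le_one, zero_smul,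
      add_zero] at hx
    exact (smul_eq_zero.1 hx).elim ha.ne' (hne _)
  generalize max 0 (2 - r) = a at ha hx
  generalize min 1 (max 0 (r - 1)) = b at hb hx
  rcases le_or_gt 1 s with hs | hs
  · obtain ⟨c, hc0, hH⟩ := htop y s hs
    rw [hH] at hx
    have h3 : a * (c * 1) + b * s = 0 := congrArg Prod.snd hx
    have : 0 < a * (c * 1) := by positivity
    have : 0 ≤ b * s := by positivity
    linarith
  · have hcase : s ≤ -1 ∨ 1 ≤ ‖y‖ := by
      rw [hr, Prod.norm_def, le_max_iff] at h1
      rcases h1 with h1 | h1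
      · exact Or.inr h1
      · rw [Real.norm_eq_abs, le_abs] at h1
        rcases h1 with h1 | h1
        · exact absurd h1 (not_le.2 hs)
        · exact Or.inl (by linarith)
    obtain ⟨c, hc0, hH⟩ := hwrap y s hcase
    rw [hH] at hx
    have h3 : a * (c * (2 * ‖y‖ - 1)) + b * s = 0 := congrArg Prod.snd hx
    have h4 : a • c • max (1 - ‖y‖) 0 • y + b • y = 0 := congrArg Prod.fst hx
    have hac : 0 < a * c := by positivity
    rw [smul_smul, smul_smul, ← add_smul, smul_eq_zero] at h4
    rcases h4 with h4 | h4
    · have hm : 0 ≤ max (1 - ‖y‖) 0 := le_max_right _ _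
      have hb0 : b = 0 := by nlinarith [mul_nonneg hac.le hm]
      have hm0 : max (1 - ‖y‖) 0 = 0 := by
        rw [hb0, add_zero] at h4
        exact (mul_eq_zero.1 h4).resolve_left hac.ne'
      have hy : 1 ≤ ‖y‖ := by linarith [le_max_left (1 - ‖y‖) 0]
      rw [hb0] at h3
      nlinarith
    · rw [h4, norm_zero] at hcase h3
      have hs' : s ≤ -1 := hcase.resolve_right (by norm_num)
      nlinarith

end sphereWrap

/-! ### A nontrivial class in `π₃` -/

/-- The identification `ℝ³ × ℝ → ℂ × ℂ`. -/
noncomputable def realToComplexPair (v : (Fin 3 → ℝ) × ℝ) : ℂ × ℂ :=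
  (v.1 0 + v.1 1 * Complex.I, v.1 2 + v.2 * Complex.I)

/-- The identification `ℂ × ℂ → ℝ³ × ℝ`, inverse to `realToComplexPair`. -/
def complexPairToReal (p : ℂ × ℂ) : (Fin 3 → ℝ) × ℝ :=
  (![p.1.re, p.1.im, p.2.re], p.2.im)

theorem continuous_realToComplexPair : Continuous realToComplexPair := by
  unfold realToComplexPair; fun_prop

theorem continuous_complexPairToReal : Continuous complexPairToReal := by
  unfold complexPairToReal
  refine Continuous.prodMk (continuous_pi fun k => ?_) (by fun_prop)
  fin_cases k <;> simp <;> fun_prop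

theorem complexPairToReal_smul_realToComplexPair (r : ℝ) (v : (Fin 3 → ℝ) × ℝ) :
    complexPairToReal (r • realToComplexPair v) = r • v := by
  refine Prod.ext (funext fun k => ?_) ?_
  · fin_cases k <;> simp [complexPairToReal, realToComplexPair]
  · simp [complexPairToReal, realToComplexPair]

theorem complexPairToReal_realToComplexPair (v : (Fin 3 → ℝ) × ℝ) :
    complexPairToReal (realToComplexPair v) = v := by
  simpa using complexPairToReal_smul_realToComplexPair 1 v

theorem realToComplexPair_ne_zero {v : (Fin 3 → ℝ) × ℝ} (hv : v ≠ 0) :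
    realToComplexPair v ≠ 0 := by
  intro h
  have := complexPairToReal_smul_realToComplexPair 0 v
  rw [zero_smul, zero_smul, ← h, complexPairToReal_realToComplexPair] at this
  exact hv this

theorem complexPairToReal_ne_zero {p : ℂ × ℂ} (hp : p ≠ 0) : complexPairToReal p ≠ 0 := by
  intro h
  apply hp
  have h0 := fun k => congrFun (congrArg Prod.fst h) k
  have h1 : p.2.im = 0 := congrArg Prod.snd h
  refine Prod.ext (Complex.ext (h0 0) (h0 1)) (Complex.ext (h0 2) h1)

/-- The map from the `3`-cube onto the boundary of the bidisk that represents a generator of `π₃`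
and sends the boundary of the cube to `(0, i)`. -/
noncomputable def cubeToBidiskBoundary (u : I^ (Fin 3)) : ℂ × ℂ :=
  ‖realToComplexPair (sphereWrap fun k => 2 * (u k : ℝ) - 1)‖⁻¹ •
    realToComplexPair (sphereWrap fun k => 2 * (u k : ℝ) - 1)

theorem continuous_cubeToBidiskBoundary : Continuous cubeToBidiskBoundary := by
  unfold cubeToBidiskBoundary
  have h : Continuous fun u : I^ (Fin 3) =>
      realToComplexPair (sphereWrap fun k => 2 * (u k : ℝ) - 1) :=
    continuous_realToComplexPair.comp (continuous_sphereWrap.comp (by fun_prop))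
  exact (h.norm.inv₀ fun u =>
    norm_ne_zero_iff.2 (realToComplexPair_ne_zero (sphereWrap_ne_zero _))).smul h

theorem norm_cubeToBidiskBoundary (u : I^ (Fin 3)) : ‖cubeToBidiskBoundary u‖ = 1 := by
  rw [cubeToBidiskBoundary, norm_smul, norm_inv, norm_norm]
  exact inv_mul_cancel₀
    (norm_ne_zero_iff.2 (realToComplexPair_ne_zero (sphereWrap_ne_zero _)))

theorem cubeToBidiskBoundary_of_mem_boundary {u : I^ (Fin 3)} (hu : u ∈ Cube.boundary (Fin 3)) :
    cubeToBidiskBoundary u = (0, Complex.I) := by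
  have h1 : ‖fun k => 2 * (u k : ℝ) - 1‖ = 1 := by
    refine le_antisymm ((pi_norm_le_iff_of_nonneg zero_le_one).2 fun k => ?_) ?_
    · rw [Real.norm_eq_abs, abs_le]
      constructor <;> linarith [(u k).2.1, (u k).2.2]
    · obtain ⟨k, hk⟩ := hu
      refine le_trans (le_of_eq ?_) (norm_le_pi_norm _ k)
      rcases hk with hk | hk <;> norm_num [hk]
  have h2 : realToComplexPair (sphereWrap fun k => 2 * (u k : ℝ) - 1) = (0, Complex.I) := by
    rw [sphereWrap_of_one_le_norm h1.ge, h1]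
    norm_num [realToComplexPair]
  rw [cubeToBidiskBoundary, h2]
  simp [Prod.norm_def]

theorem complexPairToReal_zero_I : complexPairToReal (0, Complex.I) = (0, 1) := by
  refine Prod.ext (funext fun k => ?_) ?_
  · fin_cases k <;> simp [complexPairToReal]
  · simp [complexPairToReal]

/-- If the sphere `∂(D² × D²)` sits in `X` and `X` maps to `ℂ² ∖ 0` compatibly with the inclusion
of the sphere, then `π₃(X)` is nontrivial. -/
theorem not_subsingleton_pi_three {X : Type*} [TopologicalSpace X] {incl : ℂ × ℂ → X}
    {proj : X → ℂ × ℂ} (hincl : ContinuousOn incl (Metric.sphere 0 1)) (hproj : Continuous proj)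
    (hne : ∀ x, proj x ≠ 0) (hpi : ∀ p, ‖p‖ = 1 → proj (incl p) = p) :
    ¬ Subsingleton (π_ 3 X (incl (0, Complex.I))) := by
  intro hsub
  let γ : GenLoop (Fin 3) X (incl (0, Complex.I)) :=
    ⟨⟨fun u => incl (cubeToBidiskBoundary u),
      hincl.comp_continuous continuous_cubeToBidiskBoundary fun u => by
        simpa using norm_cubeToBidiskBoundary u⟩,
      fun u hu => congrArg incl (cubeToBidiskBoundary_of_mem_boundary hu)⟩
  have hhom : GenLoop.Homotopic γ GenLoop.const :=
    Quotient.exact (hsub.elim (Quotient.mk _ γ) (Quotient.mk _ GenLoop.const))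
  obtain ⟨F⟩ := hhom
  -- Clamped affine map of `[-1, 1]` onto `I`; it extends the homotopy from the cube to all of `ℝ³ ×
  -- ℝ`.
  let c : ℝ → I := fun s => Set.projIcc 0 1 zero_le_one ((s + 1) / 2)
  have hcc : Continuous c := continuous_projIcc.comp (by fun_prop)
  have hc0 : ∀ s ≤ -1, c s = 0 := fun s hs => Set.projIcc_of_le_left _ (by linarith)
  have hc1 : ∀ s, 1 ≤ s → c s = 1 := fun s hs => Set.projIcc_of_right_le _ (by linarith)
  have hpole : complexPairToReal (proj (incl (0, Complex.I))) = (0, 1) := by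
    rw [hpi _ (by simp [Prod.norm_def]), complexPairToReal_zero_I]
  refine not_nullhomotopic_sphereWrap (Y := Fin 3 → ℝ)
    (H := fun x => complexPairToReal (proj (F (c x.2, fun k => c (x.1 k))))) ?_ ?_ ?_ ?_
  · refine continuous_complexPairToReal.comp (hproj.comp (F.continuous.comp ?_))
    exact (hcc.comp continuous_snd).prodMk
      (continuous_pi fun k => hcc.comp ((continuous_apply k).comp continuous_fst))
  · exact fun x => complexPairToReal_ne_zero (hne _)
  · intro y s hys
    rcases le_or_gt 1 ‖y‖ with hy | hy
    · obtain ⟨k, hk⟩ : ∃ k, 1 ≤ ‖y k‖ := by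
        by_contra! hlt
        exact absurd ((pi_norm_lt_iff one_pos).2 hlt) (not_lt.2 hy)
      have hmem : (fun k => c (y k)) ∈ Cube.boundary (Fin 3) := by
        refine ⟨k, ?_⟩
        rw [Real.norm_eq_abs, le_abs] at hk
        rcases hk with hk | hk
        · exact Or.inr (hc1 _ hk)
        · exact Or.inl (hc0 _ (by linarith))
      have hpos : (0 : ℝ) < 2 * ‖y‖ - 1 := by linarith
      refine ⟨(2 * ‖y‖ - 1)⁻¹, inv_pos.2 hpos, ?_⟩
      have h1 : F (c s, fun k => c (y k)) = incl (0, Complex.I) :=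
        (F.eq_fst _ hmem).trans (γ.2 _ hmem)
      rw [sphereWrap_of_one_le_norm hy, smul_smul, inv_mul_cancel₀ hpos.ne', one_smul, h1, hpole]
    · have hs := hys.resolve_right (not_le.2 hy)
      have hcy : (fun k => 2 * (c (y k) : ℝ) - 1) = y := by
        funext k
        have hk := (norm_le_pi_norm y k).trans hy.le
        rw [Real.norm_eq_abs, abs_le] at hk
        have : (c (y k) : ℝ) = (y k + 1) / 2 := by
          simp only [c]
          rw [Set.projIcc_of_mem zero_le_one
            (show (y k + 1) / 2 ∈ Set.Icc (0 : ℝ) 1 by constructor <;> linarith)]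
        rw [this]; ring
      have h1 : F (c s, fun k => c (y k)) = incl (cubeToBidiskBoundary fun k => c (y k)) := by
        rw [hc0 s hs]
        exact F.apply_zero _
      refine ⟨‖realToComplexPair (sphereWrap y)‖⁻¹,
        inv_pos.2 (norm_pos_iff.2 (realToComplexPair_ne_zero (sphereWrap_ne_zero y))), ?_⟩
      simp only
      rw [h1, hpi _ (norm_cubeToBidiskBoundary _), cubeToBidiskBoundary, hcy,
        complexPairToReal_smul_realToComplexPair]
  · intro y s hs
    refine ⟨1, one_pos, ?_⟩
    have h1 : F (c s, fun k => c (y k)) = incl (0, Complex.I) := by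
      rw [hc1 s hs]
      exact F.apply_one _
    simp only
    rw [h1, hpole, one_smul]

/-! ### The sphere inside the moment-angle complex -/

/-- If a simplicial complex `K` on `[m]` has a vertex that is not conelike, then
`Z_K(D², S¹)`, with the subspace topology from `ℂ^m`, is not aspherical. -/
theorem lemma2p3 (m : ℕ) (K : PreAbstractSimplicialComplex (Fin m))
    (hK : ∃ i : Fin m, IsVertex K i ∧ ¬ IsConelike K i) :
    ¬ IsAspherical (complexMomentAngleComplex K) := by
  intro hasph
  obtain ⟨i, hi, hcone⟩ := hK
  obtain ⟨j, hj, hji, hij⟩ : ∃ j, IsVertex K j ∧ j ≠ i ∧ ({i, j} : Finset (Fin m)) ∉ K := by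
    simpa [IsConelike] using hcone
  have hone : (fun _ => 1 : Fin m → ℂ) ∈ complexMomentAngleComplex K :=
    ⟨∅, Or.inl rfl, by simp, by simp⟩
  let e : ℂ × ℂ → Fin m → ℂ := fun p k => if k = i then p.1 else if k = j then p.2 else 1
  have he : Continuous e := by
    refine continuous_pi fun k => ?_
    simp only [e]
    split_ifs <;> fun_prop
  have hei : ∀ p, e p i = p.1 := fun p => if_pos rfl
  have hej : ∀ p, e p j = p.2 := fun p => (if_neg hji).trans (if_pos rfl)
  have hek : ∀ p k, k ≠ i → k ≠ j → e p k = 1 := fun p k h1 h2 => (if_neg h1).trans (if_neg h2)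
  have hmem : ∀ p : ℂ × ℂ, ‖p‖ = 1 → e p ∈ complexMomentAngleComplex K := by
    intro p hp
    have hp1 : ‖p.1‖ ≤ 1 := hp ▸ norm_fst_le p
    have hp2 : ‖p.2‖ ≤ 1 := hp ▸ norm_snd_le p
    -- In the sup norm, one coordinate has modulus 1; the other is the disk factor of a one-vertex
    -- face.
    rcases max_choice ‖p.1‖ ‖p.2‖ with h | h <;> rw [← Prod.norm_def, hp] at h
    · refine ⟨{j}, Or.inr hj, ?_, fun k hk => ?_⟩
      · simpa [hej] using hp2
      · rw [Finset.mem_singleton] at hk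
        by_cases hki : k = i
        · simp [hki, hei, ← h]
        · simp [hek p k hki hk]
    · refine ⟨{i}, Or.inr hi, ?_, fun k hk => ?_⟩
      · simpa [hei] using hp1
      · rw [Finset.mem_singleton] at hk
        by_cases hkj : k = j
        · simp [hkj, hej, ← h]
        · simp [hek p k hk hkj]
  classical
  -- The value off the sphere is arbitrary; only continuity on the sphere is needed.
  let incl : ℂ × ℂ → complexMomentAngleComplex K := fun p =>
    if hp : ‖p‖ = 1 then ⟨e p, hmem p hp⟩ else ⟨_, hone⟩
  have hincl : ∀ p, ‖p‖ = 1 → (incl p : Fin m → ℂ) = e p := fun p hp => by simp [incl, hp]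
  refine not_subsingleton_pi_three (incl := incl)
    (proj := fun x : complexMomentAngleComplex K => ((x : Fin m → ℂ) i, (x : Fin m → ℂ) j))
    ?_ ?_ ?_ ?_ (hasph.subsingleton_pi 3 (by norm_num) _)
  · rw [Topology.IsInducing.subtypeVal.continuousOn_iff]
    exact he.continuousOn.congr fun p hp => hincl p (by simpa using hp)
  · exact ((continuous_apply i).comp continuous_subtype_val).prodMk
      ((continuous_apply j).comp continuous_subtype_val)
  · rintro ⟨x, hx⟩ h0
    obtain ⟨J, hJ, -, hJB⟩ := id hx
    have hxi : x i = 0 := congrArg Prod.fst h0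
    have hxj : x j = 0 := congrArg Prod.snd h0
    -- A zero coordinate is not on the circle, so its index lies in `J`.
    have hiJ : i ∈ J := by
      by_contra h
      simpa [hxi] using hJB i h
    have hjJ : j ∈ J := by
      by_contra h
      simpa [hxj] using hJB j h
    rcases hJ with rfl | hJ
    · simp at hiJ
    · exact hij (K.isRelLowerSet_faces.mem_of_le hJ
        (Finset.insert_subset hiJ (Finset.singleton_subset_iff.2 hjJ)) ⟨i, by simp⟩)
  · intro p hp
    simp only [hincl p hp, hei, hej]
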